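/- **Theorem.** There is a universal constant $K>0$ such that the following holds. Let $(\mathcal S,\mathcal B)$ be a measurable space and let $P$ be a Markov transition kernel on $\mathcal S$ that admits a stationary probability distribution $\pi$ and satisfies the minorization condition with $m=1$: there are a set $C\in\mathcal B$, a number $\delta>0$ and a probability measure $\nu$ on $\mathcal S$ such that $$P(x,A)\ge\delta\,\nu(A)\quad\text{for all }x\in C,\ A\in\mathcal B,\qquad\text{and}\qquad \forall x\in\mathcal S\ \exists k\in\mathbb N:\ P^k(x,C)>0 .$$ Let $X_1,X_2,\dots$ be a homogeneous Markov chain with values in $\mathcal S$, transition kernel $P$ and an arbitrary initial distribution $\xi$. Let $(\tilde X_k,R_k)_{k\ge1}$ be the associated split chain on $\mathcal S\times\{0,1\}$: $\tilde X_1$ has law $\xi$; given the past and $\tilde X_k=x$, the coin $R_k$ equals $1$ with probability $\delta$ if $x\in C$, and $R_k=0$ if $x\notin C$; given the past, $\tilde X_k=x$ and $R_k$, the next state $\tilde X_{k+1}$ is drawn from $\nu$ if $R_k=1$, from $\frac{P(x,\cdot)-\delta\nu}{1-\delta}$ if $R_k=0$ and $x\in C$ (with $\delta<1$; for $\delta=1$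 this case has probability $0$), and from $P(x,\cdot)$ if $x\notin C$. Put $$T_1=\inf\{k>0: R_k=1\},\qquad T_2=\inf\{k>0: R_{T_1+k}=1\},$$ with value $\infty$ if there is no such $k$ (or, for $T_2$, if $T_1=\infty$). For a random variable $Z$ let $\|Z\|_{\psi_1}=\inf\{\lambda>0:\ \mathbb E(e^{|Z|/\lambda}-1)\le1\}$, with $\inf\emptyset=\infty$. Assume that $\|T_1\|_{\psi_1}\le\tau$ and $\|T_2\|_{\psi_1}\le\tau$ for a real number $\tau$. Let $n\ge1$, $L>0$, and let $f:\mathcal S^n\to\mathbb R$ be a measurable function that is invariant under all permutations of its arguments and satisfies $$|f(x_1,\dots,x_n)-f(y_1,\dots,y_n)|\le L\,\#\{i: x_i\ne y_i\}\qquad\text{for all }x,y\in\mathcal S^n .$$ Then for all $t\ge0$ $$\mathbb P\big(|f(X_1,\dots,X_n)-\mathbb E f(X_1,\dots,X_n)|\ge t\big)\le 2\exp\Big(-\frac1K\,\frac{t^2}{nL^2\tau^2}\Big).$$ -/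

import Mathlib

open MeasureTheory ProbabilityTheory
open scoped ENNReal

noncomputable section

namespace MarkovSplit

/-- The `k`-step transition kernel `P^k` of a transition kernel `P`. -/
def stepKernel {S : Type*} [MeasurableSpace S] (P : Kernel S S) : ℕ → Kernel S S
  | 0 => Kernel.id
  | k + 1 => P ∘ₖ stepKernel P k

lemma stepKernel_one {S : Type*} [MeasurableSpace S] (P : Kernel S S) : stepKernel P 1 = P := by
  simp [stepKernel]

/-- The minorization condition with parameters `m`, `δ`, small set `C` and minorizing probability
measure `ν`. -/
structure Minorization {S : Type*} [MeasurableSpace S] (P : Kernel S S) (m : ℕ) (C : Set S)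
    (δ : ℝ) (ν : Measure S) : Prop where
  m_pos : 0 < m
  measurableSet : MeasurableSet C
  delta_pos : 0 < δ
  isProbabilityMeasure : IsProbabilityMeasure ν
  minor : ∀ x ∈ C, ∀ A, MeasurableSet A → ENNReal.ofReal δ * ν A ≤ stepKernel P m x A
  access : ∀ x, ∃ k : ℕ, 0 < stepKernel P (k * m) x C

/-- The process `X` on the probability space `(Ω, μ)` is a homogeneous Markov chain with initial
distribution `ξ` and transition kernel `P`: the conditional distribution of the next state given
the whole past is `P` evaluated at the current state. -/
structure IsMarkovChain {Ω S : Type*} [MeasurableSpace Ω] [MeasurableSpace S] (X : ℕ → Ω → S)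
    (ξ : Measure S) (P : Kernel S S) (μ : Measure Ω) : Prop where
  measurable : ∀ k, Measurable (X k)
  initial : HasLaw (X 0) ξ μ
  step : ∀ k, HasCondDistrib (X (k + 1)) (fun ω (i : Finset.Iic k) => X i ω)
    (P.comap (fun past : (Finset.Iic k → S) => past ⟨k, by simp⟩) (measurable_pi_apply _)) μ

/-- The law, on the path space `ℕ → S`, of the homogeneous Markov chain with initial distribution
`ξ` and transition kernel `P`. -/
def chainLaw {S : Type*} [MeasurableSpace S] (ξ : Measure S) (P : Kernel S S)
    [IsMarkovKernel P] : Measure (ℕ → S) :=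
  Kernel.trajMeasure (X := fun _ => S) ξ fun k =>
    P.comap (fun past : (Finset.Iic k → S) => past ⟨k, by simp⟩) (measurable_pi_apply _)

section Split

variable {S : Type*} [MeasurableSpace S] {P : Kernel S S} {C : Set S} {δ : ℝ} {ν : Measure S}

lemma Minorization.smul_le (h : Minorization P 1 C δ ν) {x : S} (hx : x ∈ C) :
    ENNReal.ofReal δ • ν ≤ P x := by
  refine Measure.le_iff.2 fun A hA => ?_
  simpa [stepKernel_one] using h.minor x hx A hA

lemma Minorization.delta_le_one [IsMarkovKernel P] (h : Minorization P 1 C δ ν) {x : S}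
    (hx : x ∈ C) : δ ≤ 1 := by
  have := h.isProbabilityMeasure
  simpa [stepKernel_one] using h.minor x hx Set.univ MeasurableSet.univ

/-- The coin: from `x ∈ C` it shows `true` with probability `δ`; outside `C` it is always
`false`. -/
def coinKernel (h : Minorization P 1 C δ ν) : Kernel S Bool :=
  open Classical in
  Kernel.piecewise h.measurableSet
    (Kernel.const S (ENNReal.ofReal δ • Measure.dirac true
      + ENNReal.ofReal (1 - δ) • Measure.dirac false))
    (Kernel.const S (Measure.dirac false))

/-- The distribution of the next state after an unsuccessful toss (or no toss at all): it is
`(P(x, ·) - δ ν) / (1 - δ)` for `x ∈ C` and `P(x, ·)` for `x ∉ C`. If `δ = 1` and `x ∈ C`, then an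
unsuccessful toss has probability zero and the value is immaterial; it is set to `P(x, ·)`. -/
def residualKernel (h : Minorization P 1 C δ ν) : Kernel S S where
  toFun := open Classical in fun x =>
    if x ∈ C ∧ δ < 1 then (ENNReal.ofReal (1 - δ))⁻¹ • (P x - ENNReal.ofReal δ • ν) else P x
  measurable' := by
    classical
    have := h.isProbabilityMeasure
    have hset : MeasurableSet {x : S | x ∈ C ∧ δ < 1} :=
      h.measurableSet.inter (MeasurableSet.const _)
    refine Measure.measurable_of_measurable_coe _ fun A hA => ?_
    have hcoe : ∀ x, (if x ∈ C ∧ δ < 1 then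
          (ENNReal.ofReal (1 - δ))⁻¹ • (P x - ENNReal.ofReal δ • ν) else P x) A
        = if x ∈ C ∧ δ < 1 then
          (ENNReal.ofReal (1 - δ))⁻¹ * (P x A - ENNReal.ofReal δ * ν A) else P x A := by
      intro x
      split_ifs with hx
      · have : IsFiniteMeasure (ENNReal.ofReal δ • ν) :=
          Measure.smul_finite ν ENNReal.ofReal_ne_top
        rw [Measure.smul_apply, Measure.sub_apply hA (h.smul_le hx.1)]
        simp
      · rfl
    simp_rw [hcoe]
    exact Measurable.ite hset
      (((Kernel.measurable_coe P hA).sub measurable_const).const_mul _)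
      (Kernel.measurable_coe P hA)

/-- One step of the state component: from `(x, true)` the next state is drawn from `ν`, from
`(x, false)` it is drawn from the residual distribution. -/
def nextStateKernel (h : Minorization P 1 C δ ν) : Kernel (S × Bool) S :=
  open Classical in
  Kernel.piecewise (s := Prod.snd ⁻¹' {true})
    (measurable_snd (measurableSet_singleton true))
    (Kernel.const (S × Bool) ν)
    ((residualKernel h).comap Prod.fst measurable_fst)

lemma nextStateKernel_true (h : Minorization P 1 C δ ν) (x : S) :
    nextStateKernel h (x, true) = ν := by
  simp [nextStateKernel, Kernel.piecewise_apply]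

lemma nextStateKernel_false (h : Minorization P 1 C δ ν) (x : S) :
    nextStateKernel h (x, false) = residualKernel h x := by
  simp [nextStateKernel, Kernel.piecewise_apply, Kernel.comap_apply]

/-- The transition kernel of the split chain on `S × {0, 1}`: draw the next state, then toss the
coin at that state. -/
def splitKernel (h : Minorization P 1 C δ ν) : Kernel (S × Bool) (S × Bool) :=
  nextStateKernel h ⊗ₖ Kernel.prodMkLeft (S × Bool) (coinKernel h)

instance [IsMarkovKernel P] (h : Minorization P 1 C δ ν) : IsMarkovKernel (coinKernel h) := by
  classical
  refine ⟨fun x => ⟨?_⟩⟩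
  by_cases hx : x ∈ C
  · have h1 := h.delta_le_one hx
    simp [coinKernel, Kernel.piecewise_apply, hx,
      ← ENNReal.ofReal_add h.delta_pos.le (sub_nonneg.2 h1)]
  · simp [coinKernel, Kernel.piecewise_apply, hx]

instance [IsMarkovKernel P] (h : Minorization P 1 C δ ν) : IsMarkovKernel (residualKernel h) := by
  classical
  have := h.isProbabilityMeasure
  refine ⟨fun x => ⟨?_⟩⟩
  by_cases hx : x ∈ C ∧ δ < 1
  · have : IsFiniteMeasure (ENNReal.ofReal δ • ν) :=
      Measure.smul_finite ν ENNReal.ofReal_ne_top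
    have hd : ENNReal.ofReal (1 - δ) = 1 - ENNReal.ofReal δ := by
      rw [ENNReal.ofReal_sub _ h.delta_pos.le, ENNReal.ofReal_one]
    have hne : ENNReal.ofReal (1 - δ) ≠ 0 := by
      simpa using hx.2
    simp only [residualKernel, Kernel.coe_mk, if_pos hx]
    rw [Measure.smul_apply, Measure.sub_apply MeasurableSet.univ (h.smul_le hx.1)]
    simp only [measure_univ, Measure.smul_apply, smul_eq_mul, mul_one, ← hd]
    exact ENNReal.inv_mul_cancel hne ENNReal.ofReal_ne_top
  · simp [residualKernel, if_neg hx]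

instance [IsMarkovKernel P] (h : Minorization P 1 C δ ν) : IsMarkovKernel (nextStateKernel h) := by
  have := h.isProbabilityMeasure
  refine ⟨?_⟩
  rintro ⟨x, b⟩
  cases b
  · rw [nextStateKernel_false]
    infer_instance
  · rwa [nextStateKernel_true]

instance [IsMarkovKernel P] (h : Minorization P 1 C δ ν) : IsMarkovKernel (splitKernel h) := by
  unfold splitKernel
  infer_instance

/-- The law, on the path space, of the split chain `(X̃_k, R_k)` started from the initial
distribution `ξ` of the state component (the first coin being tossed at the first state). Paths are
indexed from `0`: coordinate `k` of a path is the value at time `k + 1`. -/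
def splitLaw [IsMarkovKernel P] (h : Minorization P 1 C δ ν) (ξ : Measure S) :
    Measure (ℕ → S × Bool) :=
  chainLaw (ξ ⊗ₘ coinKernel h) (splitKernel h)

end Split

/-- For a path of the split chain, with coordinate `k` standing for time `k + 1`, and a time
`s ∈ ℕ ∪ {∞}`: the waiting time `inf {j > 0 : R at time s + j equals 1}`. It is `∞` if there is no
such `j`, in particular if `s = ∞`. -/
def waitAfter {S : Type*} (s : ℕ∞) (w : ℕ → S × Bool) : ℕ∞ :=
  sInf {j : ℕ∞ | ∃ a b : ℕ, s = a ∧ j = b + 1 ∧ (w (a + b)).2 = true}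

/-- The `i`-th regeneration time `T_1 + ... + T_i`. -/
def regenTime {S : Type*} : ℕ → (ℕ → S × Bool) → ℕ∞
  | 0, _ => 0
  | i + 1, w => regenTime i w + waitAfter (regenTime i w) w

/-- The time `T_i`, `i ≥ 1`, between consecutive regenerations (`T_1` is the time of the first
regeneration). -/
def interRegenTime {S : Type*} (i : ℕ) (w : ℕ → S × Bool) : ℕ∞ :=
  waitAfter (regenTime (i - 1) w) w

/-- The Orlicz norm `inf {c > 0 : E ψ₁(|Z| / c) ≤ 1}` with `ψ₁(x) = exp x - 1`, for a random
variable `Z` with values in `[0, ∞]`. The infimum of the empty set is `∞`. -/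
def psi1Norm {Ω : Type*} [MeasurableSpace Ω] (Z : Ω → ℝ≥0∞) (μ : Measure Ω) : ℝ≥0∞ :=
  sInf {l : ℝ≥0∞ | ∃ c : ℝ, 0 < c ∧ l = ENNReal.ofReal c ∧
    ∫⁻ ω, (EReal.exp ((Z ω / ENNReal.ofReal c : ℝ≥0∞) : EReal) - 1) ∂μ ≤ 1}

end MarkovSplit

end

/-! The argument is a martingale argument along regeneration times, run as an induction on the
number of remaining steps. The state component of the split chain has the finite-dimensional laws of
the original chain (`lintegral_states_splitLaw`), so one may work with the split chain. After each
success its future is a fresh chain whose law ℓ starts from ν.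

Let g be symmetric and L-Lipschitz for the Hamming distance, and let T be the first success time.
The conditional mean of g given the path up to T is `regenMean`: integrate out, against ℓ, the
states after T. It lies within L·min(T, N) of the fixed number ∫ g dℓ. Indeed, placing a state
before a window and dropping the last state of the window is, up to a permutation, one substitution;
this is where symmetry is needed (`IsSymmLipschitz.abs_cons_sub_le`). A variable within L·T of a
constant, with E exp(T/c) ≤ 2, has E exp(lD) ≤ B exp(l E D) with B = exp(48 (lLc)²), provided |l|Lc
≤ 1/2 (`lintegral_exp_mul_le`).

Each success opens a new block and costs one factor B. There are at most n successes, and the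
initial block costs one more, so the moment generating function is at most B^(n+1)
(`lintegral_exp_states_le`, `IsSymmLipschitz.mgf_le`). The fresh blocks inherit their exponential
moment from T₂ (`lintegral_le_of_afterHit_le`). No truncation is needed in Chernoff's bound:
deviations exceed neither Ln nor, consequently, the range in which the optimal l is admissible,
because c ≥ 1. -/

noncomputable section

namespace MarkovSplit

/-! ### Markov chains on path space and the first-step decomposition -/

section Path

variable {E : Type*}

/-- Append a new value to the past up to time `k`. -/
def extendPast (k : ℕ) (p : (Finset.Iic k → E) × E) : Finset.Iic (k + 1) → E :=
  fun i => if h : i.1 ≤ k then p.1 ⟨i.1, Finset.mem_Iic.2 h⟩ else p.2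

lemma extendPast_restrict (k : ℕ) (w : ℕ → E) :
    extendPast k (Preorder.frestrictLe k w, w (k + 1)) = Preorder.frestrictLe (k + 1) w := by
  funext i
  by_cases h : i.1 ≤ k
  · simp [extendPast, h]
  · have h1 : i.1 ≤ k + 1 := Finset.mem_Iic.1 i.2
    have h2 : i.1 = k + 1 := by omega
    simp [extendPast, h2]

/-- Put a new initial value in front of a path. -/
def consPath (y : E) (w : ℕ → E) : ℕ → E
  | 0 => y
  | k + 1 => w k

@[simp] lemma consPath_zero (y : E) (w : ℕ → E) : consPath y w 0 = y := rfl

@[simp] lemma consPath_succ (y : E) (w : ℕ → E) (k : ℕ) : consPath y w (k + 1) = w k := rfl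

end Path

section Chain

variable {Ω E : Type*} [MeasurableSpace Ω] [MeasurableSpace E]

instance (ξ : Measure E) [IsProbabilityMeasure ξ] (Q : Kernel E E) [IsMarkovKernel Q] :
    IsProbabilityMeasure (chainLaw ξ Q) := by
  unfold chainLaw
  infer_instance

/-- The transition to time `k + 1` as a kernel on the past up to time `k`. -/
abbrev pastKernel (Q : Kernel E E) (k : ℕ) : Kernel (Finset.Iic k → E) E :=
  Q.comap (fun past : (Finset.Iic k → E) => past ⟨k, by simp⟩) (measurable_pi_apply _)

lemma measurable_extendPast (k : ℕ) : Measurable (extendPast (E := E) k) := by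
  refine measurable_pi_lambda _ fun i => ?_
  by_cases h : i.1 ≤ k
  · simp only [extendPast, dif_pos h]
    exact (measurable_pi_apply _).comp measurable_fst
  · simp only [extendPast, dif_neg h]
    exact measurable_snd

lemma chainLaw_map_zero (ξ : Measure E) [IsProbabilityMeasure ξ] (Q : Kernel E E)
    [IsMarkovKernel Q] :
    (chainLaw ξ Q).map (Preorder.frestrictLe (π := fun _ => E) 0) =
      ξ.map (fun x _ => x) := by
  rw [chainLaw, Kernel.trajMeasure, Measure.map_comp _ _ (by fun_prop), Kernel.traj_map_frestrictLe,
    Kernel.partialTraj_self, Measure.id_comp]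
  congr 1

lemma chainLaw_compProd (ξ : Measure E) [IsProbabilityMeasure ξ] (Q : Kernel E E)
    [IsMarkovKernel Q] (k : ℕ) :
    (chainLaw ξ Q).map (fun w => (Preorder.frestrictLe (π := fun _ => E) k w, w (k + 1))) =
      (chainLaw ξ Q).map (Preorder.frestrictLe (π := fun _ => E) k) ⊗ₘ pastKernel Q k :=
  Kernel.map_frestrictLe_trajMeasure_compProd_eq_map_trajMeasure.symm

/-- The law of a Markov chain is determined by its initial distribution and its transition
kernel. -/
theorem IsMarkovChain.map_eq {X : ℕ → Ω → E} {ξ : Measure E} [IsProbabilityMeasure ξ]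
    {Q : Kernel E E} [IsMarkovKernel Q] {μ : Measure Ω} [IsProbabilityMeasure μ]
    (hX : IsMarkovChain X ξ Q μ) :
    μ.map (fun ω k => X k ω) = chainLaw ξ Q := by
  have hm : Measurable (fun ω k => X k ω) := measurable_pi_lambda _ hX.measurable
  have hpm : IsProbabilityMeasure (μ.map (fun ω k => X k ω)) :=
    Measure.isProbabilityMeasure_map hm.aemeasurable
  have key : ∀ k, (μ.map (fun ω k => X k ω)).map (Preorder.frestrictLe (π := fun _ => E) k) =
      (chainLaw ξ Q).map (Preorder.frestrictLe (π := fun _ => E) k) := by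
    intro k
    induction k with
    | zero =>
      rw [chainLaw_map_zero, Measure.map_map (by fun_prop) hm, ← hX.initial.map_eq,
        Measure.map_map (by fun_prop) (hX.measurable 0)]
      congr 1
      funext ω i
      have : i.1 = 0 := Nat.le_zero.1 (Finset.mem_Iic.1 i.2)
      simp [this]
    | succ k ih =>
      have e : ∀ w : ℕ → E, Preorder.frestrictLe (π := fun _ => E) (k + 1) w =
        extendPast k (Preorder.frestrictLe k w, w (k + 1)) := fun w => (extendPast_restrict k w).symm
      have e' : Preorder.frestrictLe (π := fun _ => E) (k + 1) =
        extendPast k ∘ fun w => (Preorder.frestrictLe (π := fun _ => E) k w, w (k + 1)) := funext e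
      rw [e', ← Measure.map_map (measurable_extendPast k) (by fun_prop),
        ← Measure.map_map (measurable_extendPast k) (by fun_prop), chainLaw_compProd, ← ih,
        Measure.map_map (by fun_prop) hm, Measure.map_map (by fun_prop) hm]
      congr 1
      exact (hX.step k).map_eq
  have hproj : IsProjectiveMeasureFamily
      (α := fun _ => E)
      (fun I : Finset ℕ => (chainLaw ξ Q).map (I.restrict (π := fun _ => E))) := by
    intro I J hJ
    exact (Measure.map_map (Finset.measurable_restrict₂ hJ) (Finset.measurable_restrict I)).symm
  refine IsProjectiveLimit.unique ((isProjectiveLimit_nat_iff hproj _).2 key) fun I => rfl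

lemma measurable_consPath : Measurable (fun p : E × (ℕ → E) => consPath p.1 p.2) := by
  refine measurable_pi_lambda _ fun k => ?_
  cases k with
  | zero => exact measurable_fst
  | succ k => exact (measurable_pi_apply k).comp measurable_snd

/-- The law of the future of a chain as a function of its current state. -/
def futureKernel (Q : Kernel E E) [IsMarkovKernel Q] : Kernel E (ℕ → E) :=
  Kernel.traj (X := fun _ => E) (pastKernel Q) 0 ∘ₖ
    Q.map (MeasurableEquiv.piUnique (fun _ : Finset.Iic 0 => E)).symm

lemma futureKernel_apply (Q : Kernel E E) [IsMarkovKernel Q] (y : E) :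
    futureKernel Q y = chainLaw (Q y) Q := by
  rw [futureKernel, Kernel.comp_apply, Kernel.map_apply _ (by fun_prop)]
  rfl

instance (Q : Kernel E E) [IsMarkovKernel Q] : IsMarkovKernel (futureKernel Q) :=
  ⟨fun y => by rw [futureKernel_apply]; infer_instance⟩

lemma map_future_zero (Q : Kernel E E) [IsMarkovKernel Q] (y : E) :
    (chainLaw (Q y) Q).map (fun w => w 0) = Q y := by
  have e : (fun w : ℕ → E => w 0) =
    (fun p : Finset.Iic 0 → E => p ⟨0, by simp⟩) ∘ Preorder.frestrictLe (π := fun _ => E) 0 := rfl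
  rw [e, ← Measure.map_map (by fun_prop) (by fun_prop), chainLaw_map_zero,
    Measure.map_map (by fun_prop) (by fun_prop)]
  exact Measure.map_id

/-- First-step decomposition of the law of a Markov chain. -/
theorem chainLaw_eq_map_consPath (ξ : Measure E) [IsProbabilityMeasure ξ] (Q : Kernel E E)
    [IsMarkovKernel Q] :
    chainLaw ξ Q = (ξ ⊗ₘ futureKernel Q).map (fun p => consPath p.1 p.2) := by
  have hc : ∀ k, Measurable (fun p : E × (ℕ → E) => consPath p.1 p.2 k) := fun k =>
    (measurable_pi_apply k).comp measurable_consPath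
  refine (IsMarkovChain.map_eq (X := fun k (p : E × (ℕ → E)) => consPath p.1 p.2 k) ⟨hc, ?_, ?_⟩).symm
  · exact ⟨by fun_prop, Measure.fst_compProd ξ _⟩
  · intro k
    refine ⟨by fun_prop, ?_⟩
    have hpast : Measurable (fun (p : E × (ℕ → E)) (i : Finset.Iic k) => consPath p.1 p.2 i) :=
      measurable_pi_lambda _ fun i => hc i
    refine Measure.ext_of_lintegral _ fun F hF => ?_
    have hin : Measurable fun z : Finset.Iic k → E => ∫⁻ x, F (z, x) ∂(pastKernel Q k z) :=
      Measurable.lintegral_kernel_prod_right hF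
    rw [lintegral_map hF (by fun_prop), Measure.lintegral_compProd (by fun_prop),
      Measure.lintegral_compProd hF, lintegral_map hin hpast,
      Measure.lintegral_compProd (by exact hin.comp hpast)]
    refine lintegral_congr fun y => ?_
    simp only [futureKernel_apply, consPath_succ, Kernel.comap_apply]
    cases k with
    | zero =>
      have e : ∀ w : ℕ → E, (fun i : Finset.Iic 0 => consPath y w i) = fun _ => y := by
        intro w; funext i
        have : i.1 = 0 := Nat.le_zero.1 (Finset.mem_Iic.1 i.2)
        simp [this]
      simp only [e, consPath_zero, lintegral_const, measure_univ, mul_one]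
      conv_rhs => rw [← map_future_zero Q y]
      rw [lintegral_map (by fun_prop) (by fun_prop)]
    | succ k =>
      -- The past of the extended path up to time k + 1 depends on the future only up to its time k,
      -- so the compProd identity for the future chain applies. The default value y is never read.
      let c : (Finset.Iic k → E) → Finset.Iic (k + 1) → E := fun v i =>
        consPath y (fun j => if h : j ≤ k then v ⟨j, Finset.mem_Iic.2 h⟩ else y) i
      have hcm : Measurable c := by
        refine measurable_pi_lambda _ fun i => ?_
        obtain ⟨i, hi⟩ := i
        cases i with
        | zero => exact measurable_const
        | succ i =>
          have hik : i ≤ k := by simpa using hi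
          simp only [c, consPath_succ, dif_pos hik]
          fun_prop
      have e : ∀ w : ℕ → E, (fun i : Finset.Iic (k + 1) => consPath y w i) =
          c (Preorder.frestrictLe k w) := by
        intro w; funext i
        obtain ⟨i, hi⟩ := i
        cases i with
        | zero => rfl
        | succ i =>
          have hik : i ≤ k := by simpa using hi
          simp [c, hik]
      have h1 := congrArg (fun m => ∫⁻ q, F (c q.1, q.2) ∂m) (chainLaw_compProd (Q y) Q k)
      have hF1 : Measurable fun q : (Finset.Iic k → E) × E => F (c q.1, q.2) := by fun_prop
      rw [lintegral_map hF1 (by fun_prop), Measure.lintegral_compProd hF1, lintegral_map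
        (Measurable.lintegral_kernel_prod_right hF1) (by fun_prop)] at h1
      simp only [e]
      exact h1

lemma lintegral_chainLaw (ξ : Measure E) [IsProbabilityMeasure ξ] (Q : Kernel E E)
    [IsMarkovKernel Q] {F : (ℕ → E) → ℝ≥0∞} (hF : Measurable F) :
    ∫⁻ w, F w ∂chainLaw ξ Q = ∫⁻ y, ∫⁻ w, F (consPath y w) ∂chainLaw (Q y) Q ∂ξ := by
  rw [chainLaw_eq_map_consPath, lintegral_map hF measurable_consPath,
    Measure.lintegral_compProd (by exact hF.comp measurable_consPath)]
  simp only [futureKernel_apply]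

lemma integral_chainLaw (ξ : Measure E) [IsProbabilityMeasure ξ] (Q : Kernel E E)
    [IsMarkovKernel Q] {F : (ℕ → E) → ℝ} (hF : Measurable F) {b : ℝ} (hb : ∀ w, |F w| ≤ b) :
    ∫ w, F w ∂chainLaw ξ Q = ∫ y, ∫ w, F (consPath y w) ∂chainLaw (Q y) Q ∂ξ := by
  rw [chainLaw_eq_map_consPath, integral_map measurable_consPath.aemeasurable
    hF.aestronglyMeasurable, Measure.integral_compProd]
  · simp only [futureKernel_apply]
  · exact Integrable.of_bound (hF.comp measurable_consPath).aestronglyMeasurable b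
      (Filter.Eventually.of_forall fun p => hb _)

end Chain

/-! ### Exponential moments of a variable dominated by a waiting time -/

section ExpMoment

lemma exp_le_one_add_add_sq (z : ℝ) : Real.exp z ≤ 1 + z + z ^ 2 * Real.exp |z| := by
  have h := Complex.norm_exp_sub_sum_le_norm_mul_exp (z : ℂ) 2
  have e : Complex.exp z - ∑ m ∈ Finset.range 2, (z : ℂ) ^ m / m.factorial =
      ((Real.exp z - (1 + z) : ℝ) : ℂ) := by
    simp [Finset.sum_range_succ]
  rw [e, Complex.norm_real, Complex.norm_real, Real.norm_eq_abs, Real.norm_eq_abs, sq_abs] at h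
  linarith [le_abs_self (Real.exp z - (1 + z))]

/-- Half of the exponent U absorbs the polynomial factor of the Taylor remainder and, as s ≤ 1/2,
the other half absorbs exp |z|. The factor s² survives, which makes the final bound sub-Gaussian. -/
lemma exp_le_of_abs_le {z s U : ℝ} (hU : 0 ≤ U) (hs : s ≤ 1 / 2)
    (hz : |z| ≤ s * U) : Real.exp z ≤ 1 + z + 8 * s ^ 2 * Real.exp U := by
  have h1 := exp_le_one_add_add_sq z
  have h2 : z ^ 2 ≤ s ^ 2 * U ^ 2 := by
    rw [← sq_abs, ← mul_pow]
    exact pow_le_pow_left₀ (abs_nonneg z) hz 2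
  have h3 : Real.exp |z| ≤ Real.exp (U / 2) := by
    refine Real.exp_le_exp.2 (hz.trans ?_)
    nlinarith
  -- The 8 comes from exp x ≥ x²/2 at x = U/2.
  have h4 : U ^ 2 ≤ 8 * Real.exp (U / 2) := by
    have := Real.quadratic_le_exp_of_nonneg (x := U / 2) (by positivity)
    nlinarith
  have h5 : Real.exp U = Real.exp (U / 2) * Real.exp (U / 2) := by
    rw [← Real.exp_add]
    ring_nf
  have h6 : z ^ 2 * Real.exp |z| ≤ (s ^ 2 * U ^ 2) * Real.exp (U / 2) :=
    mul_le_mul h2 h3 (Real.exp_pos _).le (by positivity)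
  have h7 : (s ^ 2 * U ^ 2) * Real.exp (U / 2) ≤
      (s ^ 2 * (8 * Real.exp (U / 2))) * Real.exp (U / 2) := by gcongr
  rw [h5]
  linarith

/-- Sub-Gaussian bound on a restricted range of parameters for a variable that is within `L * T`
of a constant, where `T` has an exponential moment. -/
lemma lintegral_exp_mul_le {Ω : Type*} [MeasurableSpace Ω] (μ : Measure Ω)
    [IsProbabilityMeasure μ] {D T : Ω → ℝ} (hD : Measurable D) (hT : Measurable T)
    (hT0 : ∀ ω, 0 ≤ T ω) {b : ℝ} (hTb : ∀ ω, T ω ≤ b) {L c a l : ℝ} (hL : 0 ≤ L) (hc : 0 < c)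
    (hDT : ∀ ω, |D ω - a| ≤ L * T ω) (hexp : ∫⁻ ω, ENNReal.ofReal (Real.exp (T ω / c)) ∂μ ≤ 2)
    (hs : |l| * L * c ≤ 1 / 2) :
    ∫⁻ ω, ENNReal.ofReal (Real.exp (l * D ω)) ∂μ ≤
      ENNReal.ofReal (Real.exp (48 * (l * L * c) ^ 2) * Real.exp (l * ∫ ω, D ω ∂μ)) := by
  have iT : Integrable T μ := Integrable.of_bound hT.aestronglyMeasurable b
    (Filter.Eventually.of_forall fun ω => by
      rw [Real.norm_eq_abs, abs_of_nonneg (hT0 ω)]; exact hTb ω)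
  have iE : Integrable (fun ω => Real.exp (T ω / c)) μ := Integrable.of_bound
    (by fun_prop) (Real.exp (b / c)) (Filter.Eventually.of_forall fun ω => by
      rw [Real.norm_eq_abs, Real.abs_exp]
      exact Real.exp_le_exp.2 (by have := hTb ω; gcongr))
  have iDa : Integrable (fun ω => D ω - a) μ := (iT.const_mul L).mono' (by fun_prop)
    (Filter.Eventually.of_forall hDT)
  have iD : Integrable D μ := by
    exact (iDa.add (integrable_const a)).congr (Filter.Eventually.of_forall fun ω => by simp)
  have hE : ∫ ω, Real.exp (T ω / c) ∂μ ≤ 2 := by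
    rw [integral_eq_lintegral_of_nonneg_ae (Filter.Eventually.of_forall fun ω => (Real.exp_pos _).le)
      (by fun_prop)]
    exact ENNReal.toReal_le_of_le_ofReal (by norm_num) (by simpa using hexp)
  set m := ∫ ω, D ω ∂μ with hm
  set u := ∫ ω, T ω ∂μ with hu
  have hu0 : 0 ≤ u := integral_nonneg hT0
  -- Integrate 1 + T/c ≤ exp(T/c), whose right side has mean at most 2.
  have huc : u / c ≤ 1 := by
    have h1 : ∫ ω, (T ω / c + 1) ∂μ ≤ ∫ ω, Real.exp (T ω / c) ∂μ :=
      integral_mono ((iT.div_const c).add (integrable_const 1)) iE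
        fun ω => Real.add_one_le_exp _
    rw [integral_add (iT.div_const c) (integrable_const 1), integral_div] at h1
    simp only [integral_const, probReal_univ, smul_eq_mul, mul_one] at h1
    linarith
  -- The reference constant a need not be the mean; recentring at m costs only L·E T.
  have hma : |m - a| ≤ L * u := by
    have h1 : m - a = ∫ ω, (D ω - a) ∂μ := by
      rw [integral_sub iD (integrable_const a)]
      simp [hm]
    rw [h1, hu, ← integral_const_mul]
    exact (abs_integral_le_integral_abs).trans
      (integral_mono iDa.abs (iT.const_mul L) hDT)
  set s := |l| * L * c with hsdef
  have hs0 : 0 ≤ s := by positivity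
  have hss : s ^ 2 = (l * L * c) ^ 2 := by
    rw [hsdef, mul_pow, mul_pow, sq_abs, mul_pow, mul_pow]
  -- Apply the pointwise bound with U = (T + E T)/c. Since exp(E T/c) ≤ e ≤ 3, the constant is 8·3 =
  -- 24; the mean of exp(T/c) then doubles it to 48, and the linear term integrates to zero.
  have hpt : ∀ ω, Real.exp (l * (D ω - m)) ≤
      1 + l * (D ω - m) + 24 * s ^ 2 * Real.exp (T ω / c) := by
    intro ω
    have hU : 0 ≤ T ω / c + u / c := by have := hT0 ω; positivity
    have h1 : |l * (D ω - m)| ≤ s * (T ω / c + u / c) := by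
      have h2 : |D ω - m| ≤ L * T ω + L * u := by
        have : D ω - m = (D ω - a) - (m - a) := by ring
        rw [this]
        exact (abs_sub _ _).trans (add_le_add (hDT ω) hma)
      have h3 : s * (T ω / c + u / c) = |l| * (L * T ω + L * u) := by
        rw [hsdef]; field_simp
      rw [abs_mul, h3]
      gcongr
    have h4 := exp_le_of_abs_le hU hs h1
    have h5 : Real.exp (T ω / c + u / c) ≤ Real.exp (T ω / c) * 3 := by
      rw [Real.exp_add]
      have : Real.exp (u / c) ≤ 3 :=
        (Real.exp_le_exp.2 huc).trans (by linarith [Real.exp_one_lt_d9])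
      gcongr
    have h6 : 8 * s ^ 2 * Real.exp (T ω / c + u / c) ≤ 8 * s ^ 2 * (Real.exp (T ω / c) * 3) := by
      gcongr
    linarith
  have i0 : Integrable (fun ω => D ω - m) μ := iD.sub (integrable_const m)
  have i1 : Integrable (fun ω => 1 + l * (D ω - m)) μ := (integrable_const 1).add (i0.const_mul l)
  have iR : Integrable (fun ω => 1 + l * (D ω - m) + 24 * s ^ 2 * Real.exp (T ω / c)) μ :=
    i1.add (iE.const_mul _)
  have hR : ∫ ω, (1 + l * (D ω - m) + 24 * s ^ 2 * Real.exp (T ω / c)) ∂μ ≤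
      Real.exp (48 * s ^ 2) := by
    rw [integral_add i1 (iE.const_mul _), integral_add (integrable_const 1) (i0.const_mul l),
      integral_const_mul, integral_const_mul, integral_sub iD (integrable_const m)]
    simp only [integral_const, probReal_univ, smul_eq_mul, mul_one, one_mul, ← hm, sub_self,
      mul_zero, add_zero]
    have h1 : 24 * s ^ 2 * ∫ ω, Real.exp (T ω / c) ∂μ ≤ 24 * s ^ 2 * 2 := by gcongr
    linarith [Real.add_one_le_exp (48 * s ^ 2)]
  have hsplit : ∀ ω, ENNReal.ofReal (Real.exp (l * D ω)) =
      ENNReal.ofReal (Real.exp (l * (D ω - m))) * ENNReal.ofReal (Real.exp (l * m)) := by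
    intro ω
    rw [← ENNReal.ofReal_mul (Real.exp_pos _).le, ← Real.exp_add]
    ring_nf
  simp_rw [hsplit]
  rw [lintegral_mul_const _ (by fun_prop), ENNReal.ofReal_mul (Real.exp_pos _).le, ← hss]
  gcongr
  calc ∫⁻ ω, ENNReal.ofReal (Real.exp (l * (D ω - m))) ∂μ
      ≤ ∫⁻ ω, ENNReal.ofReal (1 + l * (D ω - m) + 24 * s ^ 2 * Real.exp (T ω / c)) ∂μ :=
        lintegral_mono fun ω => ENNReal.ofReal_le_ofReal (hpt ω)
    _ = ENNReal.ofReal (∫ ω, (1 + l * (D ω - m) + 24 * s ^ 2 * Real.exp (T ω / c)) ∂μ) :=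
        (ofReal_integral_eq_lintegral_ofReal iR (Filter.Eventually.of_forall fun ω =>
          (Real.exp_pos _).le.trans (hpt ω))).symm
    _ ≤ _ := ENNReal.ofReal_le_ofReal hR

end ExpMoment

/-! ### Symmetric functions Lipschitz in the Hamming distance -/

section SymmLipschitz

lemma measurable_finCons {S : Type*} [MeasurableSpace S] (N : ℕ) :
    Measurable (fun p : S × (Fin N → S) => (Fin.cons p.1 p.2 : Fin (N + 1) → S)) := by
  refine measurable_pi_lambda _ fun i => ?_
  induction i using Fin.cases with
  | zero => simpa using measurable_fst
  | succ i =>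
    simp only [Fin.cons_succ]
    fun_prop

lemma hammingDist_finCons {S : Type*} [DecidableEq S] {N : ℕ} (x y : S) (u v : Fin N → S) :
    hammingDist (Fin.cons x u : Fin (N + 1) → S) (Fin.cons y v) =
      (if x ≠ y then 1 else 0) + hammingDist u v := by
  simp only [hammingDist, Finset.card_filter, Fin.sum_univ_succ, Fin.cons_zero, Fin.cons_succ]

/-- Measurable symmetric functions of `N` variables that are `L`-Lipschitz with respect to the
Hamming distance. -/
structure IsSymmLipschitz {S : Type*} [MeasurableSpace S] [DecidableEq S] (N : ℕ) (L : ℝ)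
    (g : (Fin N → S) → ℝ) : Prop where
  measurable : Measurable g
  symm : ∀ (σ : Equiv.Perm (Fin N)) (x : Fin N → S), g (fun i => x (σ i)) = g x
  lip : ∀ x y : Fin N → S, |g x - g y| ≤ L * (hammingDist x y : ℝ)

variable {S : Type*} [MeasurableSpace S] [DecidableEq S] {N : ℕ} {L : ℝ}

lemma IsSymmLipschitz.neg {g : (Fin N → S) → ℝ} (h : IsSymmLipschitz N L g) :
    IsSymmLipschitz N L (fun x => -g x) where
  measurable := h.measurable.neg
  symm σ x := by rw [h.symm]
  lip x y := by
    rw [neg_sub_neg, abs_sub_comm]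
    exact h.lip x y

lemma IsSymmLipschitz.abs_sub_le {g : (Fin N → S) → ℝ} (h : IsSymmLipschitz N L g) (hL : 0 ≤ L)
    (x y : Fin N → S) : |g x - g y| ≤ L * N := by
  refine (h.lip x y).trans ?_
  gcongr
  simpa using hammingDist_le_card_fintype (x := x) (y := y)

lemma IsSymmLipschitz.exists_bound {g : (Fin N → S) → ℝ} (h : IsSymmLipschitz N L g)
    (hL : 0 ≤ L) : ∃ b, ∀ x, |g x| ≤ b := by
  rcases isEmpty_or_nonempty (Fin N → S) with he | ⟨⟨x₀⟩⟩
  · exact ⟨0, fun x => (he.false x).elim⟩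
  · refine ⟨|g x₀| + L * N, fun x => ?_⟩
    have h1 := h.abs_sub_le hL x x₀
    have h2 := abs_sub_abs_le_abs_sub (g x) (g x₀)
    linarith

/-- Freezing the first argument keeps the class stable, which is what permits induction on the
number of remaining states. Permutations of the tail extend by fixing 0. -/
lemma IsSymmLipschitz.cons {g : (Fin (N + 1) → S) → ℝ} (h : IsSymmLipschitz (N + 1) L g) (x : S) :
    IsSymmLipschitz N L (fun v => g (Fin.cons x v)) where
  measurable := h.measurable.comp ((measurable_finCons N).comp measurable_prodMk_left)
  symm σ v := by
    rw [← h.symm (Equiv.Perm.decomposeFin.symm (0, σ)) (Fin.cons x v)]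
    congr 1
    funext i
    induction i using Fin.cases with
    | zero => simp
    | succ i => simp
  lip u v := by
    have := h.lip (Fin.cons x u) (Fin.cons x v)
    rwa [hammingDist_finCons, if_neg (by simp), zero_add] at this

/-- Replacing a window of a sequence by the window shifted by one changes a symmetric Lipschitz
function by at most `L`. -/
lemma IsSymmLipschitz.abs_cons_sub_le {g : (Fin (N + 1) → S) → ℝ}
    (h : IsSymmLipschitz (N + 1) L g) (hL : 0 ≤ L) (x : S) (y : ℕ → S) :
    |g (Fin.cons x fun i : Fin N => y i) - g (fun i => y i)| ≤ L := by
  -- A cyclic rotation moves the last entry to the front; the two arguments then differ at most in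
  -- their first entry.
  have e : g (fun i => y i) = g (Fin.cons (y N) fun i : Fin N => y i) := by
    rw [← h.symm (finRotate (N + 1)) (Fin.cons (y N) fun i : Fin N => y i)]
    congr 1
    funext i
    induction i using Fin.lastCases with
    | last => simp
    | cast i => simp
  rw [e]
  refine (h.lip _ _).trans ?_
  rw [hammingDist_finCons, hammingDist_self, add_zero]
  split_ifs <;> simp [hL]

end SymmLipschitz

-- Conditioning on the path up to the first success

universe u

/-- The path seen from time one on. -/
def shiftPath {E : Type*} (w : ℕ → E) : ℕ → E := fun k => w (k + 1)

lemma shiftPath_consPath {E : Type*} (y : E) (w : ℕ → E) : shiftPath (consPath y w) = w := rfl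

@[fun_prop]
lemma measurable_shiftPath {E : Type*} [MeasurableSpace E] :
    Measurable (shiftPath : (ℕ → E) → ℕ → E) :=
  measurable_pi_lambda _ fun k => measurable_pi_apply (k + 1)

/-- The first `N` states of a path of the split chain. -/
def states {S : Type*} (N : ℕ) (w : ℕ → S × Bool) : Fin N → S := fun i => (w i).1

lemma states_succ {S : Type*} (N : ℕ) (w : ℕ → S × Bool) :
    states (N + 1) w = Fin.cons (w 0).1 (states N (shiftPath w)) := by
  funext i
  induction i using Fin.cases with
  | zero => rfl
  | succ => rfl

@[fun_prop]
lemma measurable_states {S : Type*} [MeasurableSpace S] (N : ℕ) :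
    Measurable (states N : (ℕ → S × Bool) → Fin N → S) :=
  measurable_pi_lambda _ fun _ => measurable_fst.comp (measurable_pi_apply _)

/-- The time of the first successful toss, capped at `N`. -/
def cappedWait {S : Type*} : ℕ → (ℕ → S × Bool) → ℕ
  | 0, _ => 0
  | N + 1, w => if (w 0).2 = true then 1 else cappedWait N (shiftPath w) + 1

/-- The conditional mean of `g` applied to the first `N` states, given the path up to the first
successful toss, when the path after a successful toss has law `ℓ`. -/
def regenMean {S : Type*} [MeasurableSpace S] (ℓ : Measure (ℕ → S × Bool)) :
    (N : ℕ) → ((Fin N → S) → ℝ) → (ℕ → S × Bool) → ℝ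
  | 0, g, w => g (states 0 w)
  | N + 1, g, w =>
    if (w 0).2 = true then ∫ v, g (Fin.cons (w 0).1 (states N v)) ∂ℓ
    else regenMean ℓ N (fun x => g (Fin.cons (w 0).1 x)) (shiftPath w)

/-- The value of `F` on the path after the first successful toss, if that toss occurs within the
first `M` ones, and zero otherwise. -/
def afterHit {S : Type*} (F : (ℕ → S × Bool) → ℝ≥0∞) : ℕ → (ℕ → S × Bool) → ℝ≥0∞
  | 0, _ => 0
  | M + 1, w => if (w 0).2 = true then F (shiftPath w) else afterHit F M (shiftPath w)

section Measurability

variable {S : Type u} [MeasurableSpace S]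

lemma measurableSet_coin : MeasurableSet {w : ℕ → S × Bool | (w 0).2 = true} :=
  (measurable_snd.comp (measurable_pi_apply 0)) (measurableSet_singleton true)

lemma measurable_cappedWait (N : ℕ) :
    Measurable (cappedWait N : (ℕ → S × Bool) → ℕ) := by
  induction N with
  | zero => exact measurable_const
  | succ N ih =>
    exact Measurable.ite measurableSet_coin measurable_const
      ((ih.comp measurable_shiftPath).add_const 1)

lemma measurable_afterHit {F : (ℕ → S × Bool) → ℝ≥0∞} (hF : Measurable F) (M : ℕ) :
    Measurable (afterHit F M) := by
  induction M with
  | zero => exact measurable_const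
  | succ M ih =>
    exact Measurable.ite measurableSet_coin (hF.comp measurable_shiftPath)
      (ih.comp measurable_shiftPath)

/-- The recursion replaces g by a function depending on the state just read, so the induction needs
joint measurability in a parameter space that grows by one factor of S per step. -/
lemma measurable_regenMean_uncurry (ℓ : Measure (ℕ → S × Bool)) [IsProbabilityMeasure ℓ] (N : ℕ) :
    ∀ {A : Type u} [MeasurableSpace A] (g : A → (Fin N → S) → ℝ),
      Measurable (fun p : A × (Fin N → S) => g p.1 p.2) →
      Measurable (fun p : A × (ℕ → S × Bool) => regenMean ℓ N (g p.1) p.2) := by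
  induction N with
  | zero =>
    intro A _ g hg
    exact hg.comp (by fun_prop : Measurable fun p : A × (ℕ → S × Bool) => (p.1, states 0 p.2))
  | succ N ih =>
    intro A _ g hg
    have hcons := measurable_finCons (S := S) N
    refine Measurable.ite (measurable_snd measurableSet_coin) ?_ ?_
    · refine StronglyMeasurable.measurable (StronglyMeasurable.integral_prod_right
        (f := fun (p : A × (ℕ → S × Bool)) v => g p.1 (Fin.cons (p.2 0).1 (states N v))) ?_)
      refine Measurable.stronglyMeasurable ?_
      have h1 : Measurable fun q : (A × (ℕ → S × Bool)) × (ℕ → S × Bool) =>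
          (Fin.cons (q.1.2 0).1 (states N q.2) : Fin (N + 1) → S) :=
        hcons.comp (by fun_prop :
          Measurable fun q : (A × (ℕ → S × Bool)) × (ℕ → S × Bool) => ((q.1.2 0).1, states N q.2))
      exact hg.comp (((measurable_fst.comp measurable_fst)).prodMk h1)
    · have h2 : Measurable fun q : (A × S) × (Fin N → S) =>
          (Fin.cons q.1.2 q.2 : Fin (N + 1) → S) :=
        hcons.comp (by fun_prop : Measurable fun q : (A × S) × (Fin N → S) => (q.1.2, q.2))
      have h3 := ih (A := A × S) (fun a x => g a.1 (Fin.cons a.2 x))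
        (hg.comp ((measurable_fst.comp measurable_fst).prodMk h2))
      exact h3.comp (by fun_prop :
        Measurable fun p : A × (ℕ → S × Bool) => ((p.1, (p.2 0).1), shiftPath p.2))

lemma measurable_regenMean (ℓ : Measure (ℕ → S × Bool)) [IsProbabilityMeasure ℓ] {N : ℕ}
    {g : (Fin N → S) → ℝ} (hg : Measurable g) : Measurable (regenMean ℓ N g) :=
  (measurable_regenMean_uncurry ℓ N (A := PUnit) (fun _ => g) (hg.comp measurable_snd)).comp
    (measurable_prodMk_left (x := PUnit.unit))

lemma abs_regenMean_le (ℓ : Measure (ℕ → S × Bool)) [IsProbabilityMeasure ℓ] {N : ℕ}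
    {g : (Fin N → S) → ℝ} {b : ℝ} (hb : ∀ x, |g x| ≤ b) (w : ℕ → S × Bool) :
    |regenMean ℓ N g w| ≤ b := by
  induction N generalizing w with
  | zero => exact hb _
  | succ N ih =>
    simp only [regenMean]
    split_ifs with h0
    · simpa using norm_integral_le_of_norm_le_const (μ := ℓ) (C := b)
        (f := fun v => g (Fin.cons (w 0).1 (states N v))) (Filter.Eventually.of_forall fun v => hb _)
    · exact ih (fun x => hb _) _

end Measurability

section CappedWait

variable {S : Type*}

lemma cappedWait_le (N : ℕ) (w : ℕ → S × Bool) : cappedWait N w ≤ N := by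
  induction N generalizing w with
  | zero => exact le_rfl
  | succ N ih =>
    have := ih (shiftPath w)
    simp only [cappedWait]
    split_ifs <;> omega

lemma cappedWait_le_of_coin (N b : ℕ) (w : ℕ → S × Bool) (h : (w b).2 = true) :
    cappedWait N w ≤ b + 1 := by
  induction N generalizing w b with
  | zero => simp [cappedWait]
  | succ N ih =>
    simp only [cappedWait]
    split_ifs with h0
    · omega
    · cases b with
      | zero => exact absurd h h0
      | succ b =>
        have := ih b (shiftPath w) h
        omega

/-- This is what lets an exponential moment of the capped time control the probability of no success
in M tosses. -/
lemma afterHit_one_eq_or_cappedWait_eq (M : ℕ) (w : ℕ → S × Bool) :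
    afterHit (fun _ => 1) M w = 1 ∨ cappedWait M w = M := by
  induction M generalizing w with
  | zero => exact Or.inr rfl
  | succ M ih =>
    simp only [afterHit, cappedWait]
    split_ifs with h0
    · exact Or.inl rfl
    · exact (ih (shiftPath w)).imp_right fun h => by rw [h]

end CappedWait

section RegenMean

variable {S : Type u} [MeasurableSpace S] [DecidableEq S] {L : ℝ}

lemma IsSymmLipschitz.integrable_states {N : ℕ} {g : (Fin N → S) → ℝ}
    (h : IsSymmLipschitz N L g) (hL : 0 ≤ L) (ℓ : Measure (ℕ → S × Bool))
    [IsProbabilityMeasure ℓ] : Integrable (fun v => g (states N v)) ℓ := by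
  obtain ⟨b, hb⟩ := h.exists_bound hL
  exact Integrable.of_bound (h.measurable.comp (measurable_states N)).aestronglyMeasurable b
    (Filter.Eventually.of_forall fun v => hb _)

/-- Up to the first successful toss the conditional mean moves by at most `L` per step. -/
lemma IsSymmLipschitz.abs_regenMean_sub_le (ℓ : Measure (ℕ → S × Bool)) [IsProbabilityMeasure ℓ]
    (hL : 0 ≤ L) {N : ℕ} {g : (Fin N → S) → ℝ} (h : IsSymmLipschitz N L g) (w : ℕ → S × Bool) :
    |regenMean ℓ N g w - ∫ v, g (states N v) ∂ℓ| ≤ L * cappedWait N w := by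
  induction N generalizing w with
  | zero =>
    have e : ∀ v : ℕ → S × Bool, states 0 v = states 0 w := fun v => Subsingleton.elim _ _
    simp [regenMean, cappedWait, e]
  | succ N ih =>
    -- One step costs L after averaging, since the shifted-window bound holds for every path v.
    have hstep : |∫ v, g (Fin.cons (w 0).1 (states N v)) ∂ℓ - ∫ v, g (states (N + 1) v) ∂ℓ| ≤ L := by
      rw [← integral_sub ((h.cons (w 0).1).integrable_states hL ℓ) (h.integrable_states hL ℓ)]
      simpa using norm_integral_le_of_norm_le_const (μ := ℓ) (C := L)
        (f := fun v => g (Fin.cons (w 0).1 (states N v)) - g (states (N + 1) v))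
        (Filter.Eventually.of_forall fun v => h.abs_cons_sub_le hL (w 0).1 fun k => (v k).1)
    simp only [regenMean, cappedWait]
    split_ifs with h0
    · simpa using hstep
    · have h1 := ih (h.cons (w 0).1) (shiftPath w)
      push_cast
      have h2 := _root_.abs_sub_le (regenMean ℓ N (fun x => g (Fin.cons (w 0).1 x)) (shiftPath w))
        (∫ v, g (Fin.cons (w 0).1 (states N v)) ∂ℓ) (∫ v, g (states (N + 1) v) ∂ℓ)
      linarith

variable {Q : Kernel (S × Bool) (S × Bool)} [IsMarkovKernel Q] {ρ : Measure (S × Bool)}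
  [IsProbabilityMeasure ρ]

/-- Tower property, proved by first-step analysis: at a success the next state law is ρ, so the
inner integral is the true conditional mean; otherwise the induction continues from the new state.
-/
lemma integral_regenMean (hQ : ∀ x, Q (x, true) = ρ) (hL : 0 ≤ L) {N : ℕ}
    {g : (Fin N → S) → ℝ} (h : IsSymmLipschitz N L g) (ξ : Measure (S × Bool))
    [IsProbabilityMeasure ξ] :
    ∫ w, regenMean (chainLaw ρ Q) N g w ∂chainLaw ξ Q = ∫ w, g (states N w) ∂chainLaw ξ Q := by
  induction N generalizing ξ with
  | zero => rfl
  | succ N ih =>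
    obtain ⟨b, hb⟩ := h.exists_bound hL
    rw [integral_chainLaw ξ Q (measurable_regenMean _ h.measurable) (abs_regenMean_le _ hb),
      integral_chainLaw ξ Q (F := fun w => g (states (N + 1) w))
        (h.measurable.comp (measurable_states _)) fun w => hb _]
    refine integral_congr_ae (Filter.Eventually.of_forall fun y => ?_)
    obtain ⟨x, r⟩ := y
    simp only [regenMean, consPath_zero, shiftPath_consPath, states_succ]
    cases r with
    | true => simp [hQ]
    | false => simpa using ih (h.cons x) (Q (x, false))

/-- The exponential moment of a symmetric Lipschitz function along the chain is controlled by that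
of its conditional mean given the path up to the first successful toss. -/
lemma lintegral_exp_states_le (hQ : ∀ x, Q (x, true) = ρ) (hL : 0 ≤ L) {c l : ℝ} (hc : 0 < c)
    (hs : |l| * L * c ≤ 1 / 2)
    (hexp : ∀ N, ∫⁻ w, ENNReal.ofReal (Real.exp (cappedWait N w / c)) ∂chainLaw ρ Q ≤ 2) {N : ℕ}
    {g : (Fin N → S) → ℝ} (h : IsSymmLipschitz N L g) (ξ : Measure (S × Bool))
    [IsProbabilityMeasure ξ] :
    ∫⁻ w, ENNReal.ofReal (Real.exp (l * g (states N w))) ∂chainLaw ξ Q ≤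
      ENNReal.ofReal (Real.exp (48 * (l * L * c) ^ 2)) ^ N *
        ∫⁻ w, ENNReal.ofReal (Real.exp (l * regenMean (chainLaw ρ Q) N g w)) ∂chainLaw ξ Q := by
  induction N generalizing ξ with
  | zero => simp [regenMean]
  | succ N ih =>
    set B := ENNReal.ofReal (Real.exp (48 * (l * L * c) ^ 2)) with hB
    -- Steps without a success use no factor B; B ≥ 1 allows the exponent to count steps instead of
    -- successes.
    have hB1 : 1 ≤ B := by
      rw [hB, ← ENNReal.ofReal_one]
      exact ENNReal.ofReal_le_ofReal (Real.one_le_exp (by positivity))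
    have hmD := measurable_regenMean (chainLaw ρ Q) h.measurable
    have hmg := h.measurable.comp (measurable_states (S := S) (N + 1))
    simp only [Function.comp_def] at hmg
    rw [lintegral_chainLaw ξ Q (hmg.const_mul l).exp.ennreal_ofReal,
      lintegral_chainLaw ξ Q (by fun_prop),
      ← lintegral_const_mul' _ _ (by finiteness)]
    refine lintegral_mono fun y => ?_
    obtain ⟨x, r⟩ := y
    simp only [regenMean, consPath_zero, shiftPath_consPath, states_succ]
    cases r with
    | true =>
      -- At a success the induction hypothesis leaves the exponential moment of the next block's
      -- conditional mean under the fresh law. It costs one B, and what remains is exp(l·mean),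
      -- where that mean is the present value of `regenMean`.
      have h1 := h.cons x
      refine (ih h1 (Q (x, true))).trans ?_
      rw [hQ, pow_succ, mul_assoc]
      gcongr
      have hT : Measurable fun w : ℕ → S × Bool => (cappedWait N w : ℝ) :=
        measurable_from_top.comp (measurable_cappedWait N)
      have h2 := lintegral_exp_mul_le (chainLaw ρ Q) (measurable_regenMean _ h1.measurable) hT
        (fun w => Nat.cast_nonneg _) (fun w => Nat.cast_le.2 (cappedWait_le N w)) hL hc
        (h1.abs_regenMean_sub_le (chainLaw ρ Q) hL) (hexp N) hs
      rw [integral_regenMean hQ hL h1 ρ, ENNReal.ofReal_mul (Real.exp_pos _).le] at h2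
      simpa using h2
    | false =>
      refine (ih (h.cons x) (Q (x, false))).trans ?_
      simp only [Bool.false_eq_true, if_false]
      gcongr
      omega

end RegenMean

/-! ### Transferring the moment of the second waiting time to the fresh chain -/

section AfterHit

variable {S : Type*} [MeasurableSpace S] {Q : Kernel (S × Bool) (S × Bool)} [IsMarkovKernel Q]
  {ρ : Measure (S × Bool)} [IsProbabilityMeasure ρ]

/-- Regeneration: the future after the first success has the fresh law independently of when that
success occurs, so the integral factors into the mean of F and the probability of a success within M
tosses. -/
lemma lintegral_afterHit (hQ : ∀ x, Q (x, true) = ρ) {F : (ℕ → S × Bool) → ℝ≥0∞}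
    (hF : Measurable F) (hfin : ∫⁻ w, F w ∂chainLaw ρ Q ≠ ∞) (M : ℕ) (ξ : Measure (S × Bool))
    [IsProbabilityMeasure ξ] :
    ∫⁻ w, afterHit F M w ∂chainLaw ξ Q =
      (∫⁻ w, F w ∂chainLaw ρ Q) * ∫⁻ w, afterHit (fun _ => 1) M w ∂chainLaw ξ Q := by
  induction M generalizing ξ with
  | zero => simp [afterHit]
  | succ M ih =>
    rw [lintegral_chainLaw ξ Q (measurable_afterHit hF _),
      lintegral_chainLaw ξ Q (measurable_afterHit measurable_const _),
      ← lintegral_const_mul' _ _ hfin]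
    refine lintegral_congr fun y => ?_
    obtain ⟨x, r⟩ := y
    simp only [afterHit, consPath_zero, shiftPath_consPath]
    cases r with
    | true => simp [hQ]
    | false => simpa using ih (Q (x, false))

/-- If the time of the first success has an exponential moment, then a bound on the mean of `F` of
the path after the first success carries over to the chain started afresh. -/
lemma lintegral_le_of_afterHit_le (hQ : ∀ x, Q (x, true) = ρ) {F : (ℕ → S × Bool) → ℝ≥0∞}
    (hF : Measurable F) (hfin : ∫⁻ w, F w ∂chainLaw ρ Q ≠ ∞) (ξ : Measure (S × Bool))
    [IsProbabilityMeasure ξ] {c : ℝ} (hc : 0 < c) {a : ℝ≥0∞}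
    (hexp : ∀ N, ∫⁻ w, ENNReal.ofReal (Real.exp (cappedWait N w / c)) ∂chainLaw ξ Q ≤ 2)
    (ha : ∀ M, ∫⁻ w, afterHit F M w ∂chainLaw ξ Q ≤ a) :
    ∫⁻ w, F w ∂chainLaw ρ Q ≤ a := by
  set κ := ∫⁻ w, F w ∂chainLaw ρ Q with hκ
  -- The error is κ times P(no success in M tosses), which is at most 2 exp(-M/c) by Markov's
  -- inequality; finiteness of κ makes it vanish as M → ∞.
  have hM : ∀ M : ℕ, κ ≤ a + κ * (ENNReal.ofReal (Real.exp (-(M / c))) * 2) := by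
    intro M
    have h1 : (1 : ℝ≥0∞) ≤ ∫⁻ w, afterHit (fun _ => 1) M w ∂chainLaw ξ Q +
        ENNReal.ofReal (Real.exp (-(M / c))) * 2 := by
      have hT : Measurable fun w : ℕ → S × Bool => (cappedWait M w : ℝ) :=
        measurable_from_top.comp (measurable_cappedWait M)
      calc (1 : ℝ≥0∞) = ∫⁻ _, 1 ∂chainLaw ξ Q := by simp
        _ ≤ ∫⁻ w, (afterHit (fun _ => 1) M w + ENNReal.ofReal (Real.exp (-(M / c))) *
              ENNReal.ofReal (Real.exp (cappedWait M w / c))) ∂chainLaw ξ Q := by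
            refine lintegral_mono fun w => ?_
            rcases afterHit_one_eq_or_cappedWait_eq M w with h | h
            · rw [h]; exact le_self_add
            · rw [h, ← ENNReal.ofReal_mul (Real.exp_pos _).le, ← Real.exp_add]
              simp
        _ ≤ _ := by
            rw [lintegral_add_left (measurable_afterHit measurable_const _),
              lintegral_const_mul _ (by fun_prop)]
            gcongr
            exact hexp M
    calc κ ≤ κ * (∫⁻ w, afterHit (fun _ => 1) M w ∂chainLaw ξ Q +
          ENNReal.ofReal (Real.exp (-(M / c))) * 2) := le_mul_of_one_le_right zero_le h1
      _ = ∫⁻ w, afterHit F M w ∂chainLaw ξ Q +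
          κ * (ENNReal.ofReal (Real.exp (-(M / c))) * 2) := by
        rw [mul_add, lintegral_afterHit hQ hF hfin]
      _ ≤ _ := by gcongr; exact ha M
  have hlim : Filter.Tendsto
      (fun M : ℕ => a + κ * (ENNReal.ofReal (Real.exp (-(M / c))) * 2)) Filter.atTop
      (nhds (a + κ * (ENNReal.ofReal 0 * 2))) := by
    have h1 : Filter.Tendsto (fun M : ℕ => Real.exp (-((M : ℝ) / c))) Filter.atTop (nhds 0) :=
      Real.tendsto_exp_neg_atTop_nhds_zero.comp
        (tendsto_natCast_atTop_atTop.atTop_div_const hc)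
    refine tendsto_const_nhds.add (ENNReal.Tendsto.const_mul ?_ (Or.inr hfin))
    exact ENNReal.Tendsto.mul_const (ENNReal.tendsto_ofReal h1) (Or.inr (by simp))
  simpa using ge_of_tendsto' hlim hM

end AfterHit

/-! ### From the Orlicz norm to exponential moments -/

section Psi1Norm

variable {Ω : Type*} [MeasurableSpace Ω] {μ : Measure Ω}

lemma exists_of_psi1Norm_lt {Z : Ω → ℝ≥0∞} {b : ℝ} (h : psi1Norm Z μ < ENNReal.ofReal b) :
    ∃ c : ℝ, 0 < c ∧ c < b ∧
      ∫⁻ ω, (EReal.exp ((Z ω / ENNReal.ofReal c : ℝ≥0∞) : EReal) - 1) ∂μ ≤ 1 := by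
  obtain ⟨_, ⟨c, hc, rfl, hint⟩, hlt⟩ := sInf_lt_iff.1 h
  exact ⟨c, hc, (ENNReal.ofReal_lt_ofReal_iff_of_nonneg hc.le).1 hlt, hint⟩

lemma ofReal_exp_div_le {c b x : ℝ} {z : ℝ≥0∞} (hc : 0 < c) (hcb : c ≤ b) (hx : 0 ≤ x)
    (hxz : ENNReal.ofReal x ≤ z) :
    ENNReal.ofReal (Real.exp (x / b)) ≤
      EReal.exp ((z / ENNReal.ofReal c : ℝ≥0∞) : EReal) := by
  rw [← EReal.exp_coe]
  refine EReal.exp_monotone ?_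
  have h1 : ((x / b : ℝ) : EReal) = ((ENNReal.ofReal (x / b) : ℝ≥0∞) : EReal) := by
    have : 0 ≤ x / b := div_nonneg hx (hc.le.trans hcb)
    rw [EReal.coe_ennreal_ofReal, max_eq_left this]
  rw [h1, EReal.coe_ennreal_le_coe_ennreal_iff, ENNReal.ofReal_div_of_pos (hc.trans_le hcb)]
  gcongr

/-- The strict inequality supplies an admissible constant below b, so no attainment of the infimum
is needed. -/
lemma lintegral_le_two_of_psi1Norm_lt [IsProbabilityMeasure μ] {Z F : Ω → ℝ≥0∞} {b : ℝ}
    (h : psi1Norm Z μ < ENNReal.ofReal b)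
    (hF : ∀ c : ℝ, 0 < c → c < b → ∀ ω,
      F ω ≤ EReal.exp ((Z ω / ENNReal.ofReal c : ℝ≥0∞) : EReal)) :
    ∫⁻ ω, F ω ∂μ ≤ 2 := by
  obtain ⟨c, hc, hcb, hint⟩ := exists_of_psi1Norm_lt h
  calc ∫⁻ ω, F ω ∂μ
      ≤ ∫⁻ ω, ((EReal.exp ((Z ω / ENNReal.ofReal c : ℝ≥0∞) : EReal) - 1) + 1) ∂μ :=
        lintegral_mono fun ω => (hF c hc hcb ω).trans le_tsub_add
    _ = ∫⁻ ω, (EReal.exp ((Z ω / ENNReal.ofReal c : ℝ≥0∞) : EReal) - 1) ∂μ + 1 := by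
        rw [lintegral_add_right _ measurable_const]
        simp
    _ ≤ 1 + 1 := by gcongr
    _ = 2 := one_add_one_eq_two

/-- If τ < 1, the scale 1 would be admissible and Z ≥ 1 would give e ≤ 2. -/
lemma one_le_of_psi1Norm_le [IsProbabilityMeasure μ] {Z : Ω → ℝ≥0∞} {τ : ℝ}
    (h : psi1Norm Z μ ≤ ENNReal.ofReal τ) (hZ : ∀ ω, 1 ≤ Z ω) : 1 ≤ τ := by
  by_contra! hτ
  have h1 : psi1Norm Z μ < ENNReal.ofReal 1 :=
    h.trans_lt ((ENNReal.ofReal_lt_ofReal_iff one_pos).2 hτ)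
  have h2 : ∫⁻ _, ENNReal.ofReal (Real.exp (1 / 1)) ∂μ ≤ 2 :=
    lintegral_le_two_of_psi1Norm_lt h1 fun c hc hcb ω =>
      ofReal_exp_div_le hc hcb.le zero_le_one (by simpa using hZ ω)
  rw [lintegral_const, measure_univ, mul_one, div_one, ← ENNReal.ofReal_ofNat,
    ENNReal.ofReal_le_ofReal_iff (by norm_num)] at h2
  linarith [Real.exp_one_gt_d9]

end Psi1Norm

/-! ### Comparing capped times with regeneration times -/

section Regeneration

variable {S : Type*}

lemma interRegenTime_one (w : ℕ → S × Bool) : interRegenTime 1 w = waitAfter 0 w := rfl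

lemma cappedWait_le_waitAfter (N a : ℕ) (w : ℕ → S × Bool) :
    (cappedWait N (fun k => w (a + k)) : ℕ∞) ≤ waitAfter a w := by
  refine le_sInf ?_
  rintro _ ⟨a', b, ha, rfl, hb⟩
  obtain rfl : a = a' := by exact_mod_cast ha
  exact_mod_cast cappedWait_le_of_coin N b (fun k => w (a + k)) hb

lemma one_le_waitAfter (s : ℕ∞) (w : ℕ → S × Bool) : 1 ≤ waitAfter s w := by
  refine le_sInf ?_
  rintro _ ⟨a, b, -, rfl, -⟩
  exact le_add_self

/-- With a first success at coordinate a, the remaining path starts at coordinate a + 1, which is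
also the value of the first regeneration time in the shifted indexing. -/
lemma afterHit_eq (F : (ℕ → S × Bool) → ℝ≥0∞) (M : ℕ) (w : ℕ → S × Bool) :
    afterHit F M w = 0 ∨ ∃ a : ℕ, (w a).2 = true ∧ (∀ b < a, (w b).2 ≠ true) ∧
      afterHit F M w = F (fun k => w (a + 1 + k)) := by
  induction M generalizing w with
  | zero => exact Or.inl rfl
  | succ M ih =>
    simp only [afterHit]
    split_ifs with h0
    · refine Or.inr ⟨0, h0, by simp, ?_⟩
      congr 1
      funext k
      simp [shiftPath, add_comm]
    · refine (ih (shiftPath w)).imp_right ?_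
      rintro ⟨a, ha, hlt, heq⟩
      refine ⟨a + 1, ha, fun b hb => ?_, ?_⟩
      · cases b with
        | zero => exact h0
        | succ b => exact hlt b (by omega)
      · rw [heq]
        congr 1
        funext k
        simp only [shiftPath]
        congr 1
        omega

lemma regenTime_one_eq {w : ℕ → S × Bool} {a : ℕ} (ha : (w a).2 = true)
    (hlt : ∀ b < a, (w b).2 ≠ true) : regenTime 1 w = ((a + 1 : ℕ) : ℕ∞) := by
  have h : waitAfter 0 w = ((a + 1 : ℕ) : ℕ∞) := by
    refine le_antisymm (sInf_le ⟨0, a, rfl, by push_cast; rfl, by simpa using ha⟩) (le_sInf ?_)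
    rintro _ ⟨a', b, ha', rfl, hb⟩
    obtain rfl : 0 = a' := by exact_mod_cast ha'
    rw [zero_add] at hb
    have : a ≤ b := not_lt.1 fun hba => hlt b hba hb
    exact_mod_cast Nat.succ_le_succ this
  simpa [regenTime] using h

lemma cappedWait_le_interRegenTime_one (N : ℕ) (w : ℕ → S × Bool) :
    ENNReal.ofReal (cappedWait N w) ≤ (interRegenTime 1 w : ℝ≥0∞) := by
  have h := cappedWait_le_waitAfter N 0 w
  simp only [zero_add, Nat.cast_zero] at h
  rw [interRegenTime_one, ENNReal.ofReal_natCast]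
  have h' := ENat.toENNReal_le.2 h
  simpa using h'

lemma afterHit_exp_le {c b : ℝ} (hc : 0 < c) (hcb : c ≤ b) (M N : ℕ) (w : ℕ → S × Bool) :
    afterHit (fun v => ENNReal.ofReal (Real.exp (cappedWait N v / b))) M w ≤
      EReal.exp (((interRegenTime 2 w : ℝ≥0∞) / ENNReal.ofReal c : ℝ≥0∞) : EReal) := by
  rcases afterHit_eq (fun v => ENNReal.ofReal (Real.exp (cappedWait N v / b))) M w with
    h | ⟨a, ha, hlt, h⟩
  · rw [h]
    exact zero_le
  · rw [h]
    refine ofReal_exp_div_le hc hcb (Nat.cast_nonneg _) ?_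
    have h1 := ENat.toENNReal_le.2 (cappedWait_le_waitAfter N (a + 1) w)
    rw [← regenTime_one_eq ha hlt] at h1
    rw [ENNReal.ofReal_natCast]
    simpa [interRegenTime] using h1

end Regeneration

/-! ### The state marginal of the split chain -/

section Marginal

variable {S : Type*} [MeasurableSpace S] {P : Kernel S S} [IsMarkovKernel P] {C : Set S} {δ : ℝ}
  {ν : Measure S} (h : Minorization P 1 C δ ν)

lemma splitKernel_apply (y : S × Bool) :
    splitKernel h y = nextStateKernel h y ⊗ₘ coinKernel h := by
  rw [splitKernel, Kernel.compProd_apply_eq_compProd_sectR]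
  congr 1

lemma chainLaw_splitKernel_apply (y : S × Bool) :
    chainLaw (splitKernel h y) (splitKernel h) = splitLaw h (nextStateKernel h y) := by
  rw [splitLaw, splitKernel_apply]

/-- Averaging the next state over the coin gives back the original transition kernel. -/
lemma lintegral_coinKernel_nextStateKernel (x : S) (G : S → ℝ≥0∞) :
    ∫⁻ r, ∫⁻ y, G y ∂nextStateKernel h (x, r) ∂coinKernel h x = ∫⁻ y, G y ∂P x := by
  classical
  have := h.isProbabilityMeasure
  by_cases hx : x ∈ C
  · have hfin : IsFiniteMeasure (ENNReal.ofReal δ • ν) :=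
      Measure.smul_finite ν ENNReal.ofReal_ne_top
    have hcoin : coinKernel h x = ENNReal.ofReal δ • Measure.dirac true
        + ENNReal.ofReal (1 - δ) • Measure.dirac false := by
      simp [coinKernel, Kernel.piecewise_apply, hx]
    rw [hcoin, lintegral_add_measure, lintegral_smul_measure, lintegral_smul_measure,
      lintegral_dirac, lintegral_dirac, nextStateKernel_true, nextStateKernel_false]
    -- For δ < 1 the residual is designed to complete δν to P(x, ·). For δ = 1 failure has weight
    -- zero, and ν ≤ P(x, ·) between probability measures forces equality.
    rcases (h.delta_le_one hx).lt_or_eq with hδ | rfl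
    · have hres : residualKernel h x =
          (ENNReal.ofReal (1 - δ))⁻¹ • (P x - ENNReal.ofReal δ • ν) := if_pos ⟨hx, hδ⟩
      have hne : ENNReal.ofReal (1 - δ) ≠ 0 := by simpa using hδ
      rw [hres, lintegral_smul_measure, smul_eq_mul, smul_eq_mul, smul_eq_mul, ← mul_assoc,
        ENNReal.mul_inv_cancel hne ENNReal.ofReal_ne_top, one_mul, ← smul_eq_mul,
        ← lintegral_smul_measure, ← lintegral_add_measure, add_comm,
        Measure.sub_add_cancel_of_le (h.smul_le hx)]
    · have hle : ν ≤ P x := by simpa using h.smul_le hx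
      simp [Measure.eq_of_le_of_isProbabilityMeasure hle]
  · have hcoin : coinKernel h x = Measure.dirac false := by
      simp [coinKernel, Kernel.piecewise_apply, hx]
    have hres : residualKernel h x = P x := if_neg fun hh => hx hh.1
    rw [hcoin, lintegral_dirac, nextStateKernel_false, hres]

/-- The state component of the split chain has the finite-dimensional distributions of the
original chain. -/
lemma lintegral_states_splitLaw (N : ℕ) {F : (Fin N → S) → ℝ≥0∞} (hF : Measurable F)
    (ξ : Measure S) [IsProbabilityMeasure ξ] :
    ∫⁻ w, F (states N w) ∂splitLaw h ξ = ∫⁻ v, F (fun i => v i) ∂chainLaw ξ P := by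
  induction N generalizing ξ with
  | zero =>
    have e1 : ∀ w : ℕ → S × Bool, states 0 w = Fin.elim0 := fun w => Subsingleton.elim _ _
    have e2 : ∀ v : ℕ → S, (fun i : Fin 0 => v i) = Fin.elim0 := fun v => Subsingleton.elim _ _
    simp_rw [e1, e2]
    simp [splitLaw]
  | succ N ih =>
    have hFs : Measurable fun w : ℕ → S × Bool => F (states (N + 1) w) := by fun_prop
    have hFc : Measurable fun p : S × (Fin N → S) => F (Fin.cons p.1 p.2) :=
      hF.comp (measurable_finCons N)
    have hkm : Measurable fun y : S × Bool => ∫⁻ w, F (states (N + 1) (consPath y w))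
        ∂chainLaw (splitKernel h y) (splitKernel h) := by
      simp_rw [← futureKernel_apply]
      exact Measurable.lintegral_kernel_prod_right (hFs.comp measurable_consPath)
    have e : ∀ (x : S) (v : ℕ → S), (fun i : Fin (N + 1) => consPath x v i) =
        Fin.cons x fun i : Fin N => v i := by
      intro x v
      funext i
      induction i using Fin.cases with
      | zero => rfl
      | succ => rfl
    have hF' : Measurable fun v : ℕ → S => F fun i => v i := by fun_prop
    rw [splitLaw, lintegral_chainLaw _ _ hFs, Measure.lintegral_compProd hkm,
      lintegral_chainLaw _ _ hF']
    refine lintegral_congr fun x => ?_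
    have hFx : Measurable fun v : Fin N → S => F (Fin.cons x v) :=
      hFc.comp measurable_prodMk_left
    have hFx' : Measurable fun v : ℕ → S => F (Fin.cons x fun i : Fin N => v i) :=
      hFx.comp (by fun_prop)
    simp only [states_succ, consPath_zero, shiftPath_consPath, chainLaw_splitKernel_apply, e]
    -- The induction hypothesis turns the split future into the original chain started from the
    -- drawn next state; averaging over the coin then restores P.
    simp_rw [ih hFx, lintegral_chainLaw _ P hFx']
    exact lintegral_coinKernel_nextStateKernel h x _

lemma map_states_splitLaw (N : ℕ) (ξ : Measure S) [IsProbabilityMeasure ξ] {Ω : Type*}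
    [MeasurableSpace Ω] {μ : Measure Ω} [IsProbabilityMeasure μ] {X : ℕ → Ω → S}
    (hX : IsMarkovChain X ξ P μ) :
    (splitLaw h ξ).map (states N) = μ.map (fun ω (i : Fin N) => X i ω) := by
  have hm : Measurable (fun ω k => X k ω) := measurable_pi_lambda _ hX.measurable
  have hm' : Measurable (fun ω (i : Fin N) => X i ω) :=
    measurable_pi_lambda _ fun i => hX.measurable i
  refine Measure.ext_of_lintegral _ fun F hF => ?_
  rw [lintegral_map hF (by fun_prop), lintegral_states_splitLaw h N hF ξ, ← hX.map_eq,
    lintegral_map (by fun_prop) hm, lintegral_map hF hm']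

end Marginal

/-! ### Chernoff bound and conclusion -/

section Concentration

lemma measure_ge_le_of_mgf_le {Ω : Type*} [MeasurableSpace Ω] {μ : Measure Ω}
    [IsProbabilityMeasure μ] {Y : Ω → ℝ} (hY : Measurable Y) {L c t : ℝ} {n : ℕ} (hn : 0 < n)
    (hL : 0 < L) (hc : 1 ≤ c) (ht : 0 ≤ t) (hYb : ∀ ω, |Y ω| ≤ L * n)
    (hmgf : ∀ l : ℝ, |l| * L * c ≤ 1 / 2 → mgf Y μ l ≤ Real.exp (96 * n * (l * L * c) ^ 2)) :
    μ.real {ω | t ≤ Y ω} ≤ Real.exp (-(t ^ 2 / (384 * n * L ^ 2 * c ^ 2))) := by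
  have hn' : (0 : ℝ) < n := by exact_mod_cast hn
  have hc0 : 0 < c := by linarith
  rcases lt_or_ge (L * n) t with htn | htn
  · have : {ω | t ≤ Y ω} = ∅ := by
      ext ω
      simp only [Set.mem_ofPred_eq, Set.mem_empty_iff_false, iff_false, not_le]
      exact ((le_abs_self _).trans (hYb ω)).trans_lt htn
    rw [this, measureReal_empty]
    exact (Real.exp_pos _).le
  -- Minimizer of -lt + 96 n (lLc)²; admissible because t ≤ Ln and c ≥ 1.
  set l := t / (192 * n * L ^ 2 * c ^ 2) with hl
  have hl0 : 0 ≤ l := by positivity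
  have hs : |l| * L * c ≤ 1 / 2 := by
    have e : |l| * L * c = t / (192 * n * L * c) := by
      rw [abs_of_nonneg hl0, hl]
      field_simp
    rw [e, div_le_iff₀ (by positivity)]
    nlinarith [mul_pos hL hn', mul_le_mul_of_nonneg_left hc (mul_pos hL hn').le]
  have hint : Integrable (fun ω => Real.exp (l * Y ω)) μ :=
    Integrable.of_bound (by fun_prop) (Real.exp (l * (L * n)))
      (Filter.Eventually.of_forall fun ω => by
        rw [Real.norm_eq_abs, Real.abs_exp]
        have := (le_abs_self _).trans (hYb ω)
        exact Real.exp_le_exp.2 (by gcongr))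
  refine (measure_ge_le_exp_mul_mgf t hl0 hint).trans ?_
  refine (mul_le_mul_of_nonneg_left (hmgf l hs) (Real.exp_pos _).le).trans ?_
  rw [← Real.exp_add, Real.exp_le_exp]
  refine le_of_eq ?_
  rw [hl]
  field_simp
  ring

/-- The moment generating function of a symmetric Lipschitz function of a Markov chain whose split
chain has exponentially integrable first two waiting times. -/
theorem IsSymmLipschitz.mgf_le {S : Type u} [MeasurableSpace S] [DecidableEq S] {P : Kernel S S}
    [IsMarkovKernel P] {C : Set S} {δ : ℝ} {ν : Measure S} (h : Minorization P 1 C δ ν)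
    {Ω : Type*} [MeasurableSpace Ω] {μ : Measure Ω} [IsProbabilityMeasure μ] {ξ : Measure S}
    [IsProbabilityMeasure ξ] {X : ℕ → Ω → S} (hX : IsMarkovChain X ξ P μ) {c : ℝ}
    (hc : 0 < c)
    (hT₁ : psi1Norm (fun w : ℕ → S × Bool => (interRegenTime 1 w : ℝ≥0∞)) (splitLaw h ξ) <
      ENNReal.ofReal c)
    (hT₂ : psi1Norm (fun w : ℕ → S × Bool => (interRegenTime 2 w : ℝ≥0∞)) (splitLaw h ξ) <
      ENNReal.ofReal c)
    {n : ℕ} (hn : 0 < n) {L : ℝ} (hL : 0 ≤ L) {g : (Fin n → S) → ℝ} (hg : IsSymmLipschitz n L g)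
    {l : ℝ} (hs : |l| * L * c ≤ 1 / 2) :
    mgf (fun ω => g (fun i => X i ω) - ∫ ω', g (fun i => X i ω') ∂μ) μ l ≤
      Real.exp (96 * n * (l * L * c) ^ 2) := by
  have := h.isProbabilityMeasure
  have hQ : ∀ x, splitKernel h (x, true) = ν ⊗ₘ coinKernel h := fun x => by
    rw [splitKernel_apply, nextStateKernel_true]
  have hTm : ∀ N, Measurable fun w : ℕ → S × Bool => (cappedWait N w : ℝ) := fun N =>
    measurable_from_top.comp (measurable_cappedWait N)
  have hexp₁ : ∀ N, ∫⁻ w, ENNReal.ofReal (Real.exp (cappedWait N w / c))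
      ∂chainLaw (ξ ⊗ₘ coinKernel h) (splitKernel h) ≤ 2 := fun N =>
    lintegral_le_two_of_psi1Norm_lt hT₁ fun c' hc' hcb w =>
      ofReal_exp_div_le hc' hcb.le (Nat.cast_nonneg _) (cappedWait_le_interRegenTime_one N w)
  have hexp₂ : ∀ N, ∫⁻ w, ENNReal.ofReal (Real.exp (cappedWait N w / c))
      ∂chainLaw (ν ⊗ₘ coinKernel h) (splitKernel h) ≤ 2 := fun N => by
    refine lintegral_le_of_afterHit_le hQ (by fun_prop) ?_ (ξ ⊗ₘ coinKernel h) hc hexp₁ fun M =>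
      lintegral_le_two_of_psi1Norm_lt hT₂ fun c' hc' hcb w => afterHit_exp_le hc' hcb.le M N w
    -- The cap at N gives the a priori finiteness needed for the limit argument.
    refine ne_top_of_le_ne_top (b := ENNReal.ofReal (Real.exp (N / c))) ENNReal.ofReal_ne_top ?_
    refine (lintegral_mono fun w => ENNReal.ofReal_le_ofReal (Real.exp_le_exp.2 ?_)).trans_eq
      (by rw [lintegral_const, measure_univ, mul_one])
    have : (cappedWait N w : ℝ) ≤ N := Nat.cast_le.2 (cappedWait_le N w)
    gcongr
  have hm' : Measurable (fun ω (i : Fin n) => X i ω) :=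
    measurable_pi_lambda _ fun i => hX.measurable i
  have hlaw := map_states_splitLaw h n ξ hX
  have hgm := hg.measurable
  set m := ∫ ω', g (fun i => X i ω') ∂μ with hm
  have hmean : m = ∫ w, g (states n w) ∂splitLaw h ξ := by
    rw [hm, ← integral_map (φ := fun ω (i : Fin n) => X i ω) hm'.aemeasurable
      hgm.aestronglyMeasurable, ← hlaw, integral_map (by fun_prop) hgm.aestronglyMeasurable]
  have hlin : ∫⁻ ω, ENNReal.ofReal (Real.exp (l * g (fun i => X i ω))) ∂μ =
      ∫⁻ w, ENNReal.ofReal (Real.exp (l * g (states n w))) ∂splitLaw h ξ := by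
    rw [← lintegral_map (f := fun x => ENNReal.ofReal (Real.exp (l * g x))) (by fun_prop) hm',
      ← hlaw, lintegral_map (by fun_prop) (by fun_prop)]
  have h1 := lintegral_exp_states_le hQ hL hc hs hexp₂ hg (ξ ⊗ₘ coinKernel h)
  have h2 := lintegral_exp_mul_le (chainLaw (ξ ⊗ₘ coinKernel h) (splitKernel h))
    (measurable_regenMean (chainLaw (ν ⊗ₘ coinKernel h) (splitKernel h)) hgm) (hTm n)
    (fun w => Nat.cast_nonneg _) (fun w => Nat.cast_le.2 (cappedWait_le n w)) hL hc
    (hg.abs_regenMean_sub_le (chainLaw (ν ⊗ₘ coinKernel h) (splitKernel h)) hL) (hexp₁ n) hs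
  rw [integral_regenMean hQ hL hg] at h2
  have h3 := h1.trans (mul_le_mul_right h2 _)
  rw [← splitLaw, ← hlin, ← hmean, ← ENNReal.ofReal_pow (Real.exp_pos _).le,
    ← ENNReal.ofReal_mul (by positivity)] at h3
  have h4 : ∫ ω, Real.exp (l * g (fun i => X i ω)) ∂μ ≤
      Real.exp (48 * (l * L * c) ^ 2) ^ n * (Real.exp (48 * (l * L * c) ^ 2) * Real.exp (l * m)) := by
    rw [integral_eq_lintegral_of_nonneg_ae
      (Filter.Eventually.of_forall fun ω => (Real.exp_pos _).le)
      (by exact ((hgm.comp hm').const_mul l).exp.aestronglyMeasurable)]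
    exact ENNReal.toReal_le_of_le_ofReal (by positivity) h3
  have h5 : mgf (fun ω => g (fun i => X i ω) - m) μ l =
      (∫ ω, Real.exp (l * g (fun i => X i ω)) ∂μ) * Real.exp (-(l * m)) := by
    rw [mgf, ← integral_mul_const]
    refine integral_congr_ae (Filter.Eventually.of_forall fun ω => ?_)
    simp only [← Real.exp_add]
    ring_nf
  rw [h5]
  refine (mul_le_mul_of_nonneg_right h4 (Real.exp_pos _).le).trans ?_
  rw [← Real.exp_nat_mul, ← Real.exp_add, ← Real.exp_add, ← Real.exp_add, Real.exp_le_exp]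
  -- The exponent is 48(n + 1)(lLc)², and n + 1 ≤ 2n.
  have hn1 : (1 : ℝ) ≤ n := by exact_mod_cast hn
  nlinarith [sq_nonneg (l * L * c)]

end Concentration

end MarkovSplit

end

theorem theorem3p3 :
    ∃ K : ℝ, 0 < K ∧
      ∀ (S : Type*) [MeasurableSpace S] [DecidableEq S]
        (P : Kernel S S) [IsMarkovKernel P]
        (C : Set S) (δ : ℝ) (ν : Measure S) (h : MarkovSplit.Minorization P 1 C δ ν)
        (_hstat : ∃ π : Measure S, IsProbabilityMeasure π ∧ P.Invariant π)
        (Ω : Type*) [MeasurableSpace Ω] (μ : Measure Ω) [IsProbabilityMeasure μ]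
        (ξ : Measure S) [IsProbabilityMeasure ξ]
        (X : ℕ → Ω → S) (_hX : MarkovSplit.IsMarkovChain X ξ P μ)
        (τ : ℝ)
        (_hT₁ : MarkovSplit.psi1Norm
          (fun w : ℕ → S × Bool => (MarkovSplit.interRegenTime 1 w : ℝ≥0∞))
          (MarkovSplit.splitLaw h ξ) ≤ ENNReal.ofReal τ)
        (_hT₂ : MarkovSplit.psi1Norm
          (fun w : ℕ → S × Bool => (MarkovSplit.interRegenTime 2 w : ℝ≥0∞))
          (MarkovSplit.splitLaw h ξ) ≤ ENNReal.ofReal τ)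
        (n : ℕ) (_hn : 0 < n) (f : (Fin n → S) → ℝ) (_hf : Measurable f)
        (_hsymm : ∀ (σ : Equiv.Perm (Fin n)) (x : Fin n → S), f (fun i => x (σ i)) = f x)
        (L : ℝ) (_hL : 0 < L)
        (_hLip : ∀ x y : Fin n → S, |f x - f y| ≤ L * (hammingDist x y : ℝ))
        (t : ℝ) (_ht : 0 ≤ t),
        μ.real {ω | t ≤ |f (fun i => X i ω) - ∫ ω', f (fun i => X i ω') ∂μ|}
          ≤ 2 * Real.exp (-(1 / K * (t ^ 2 / (n * L ^ 2 * τ ^ 2)))) := by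
  -- 1536 = 384·2²: the bound is used with c = 2τ, since τ ≥ 1 makes 2τ strictly larger than both
  -- norms.
  refine ⟨1536, by norm_num, ?_⟩
  intro S _ _ P _ C δ ν h _ Ω _ μ _ ξ _ X hX τ hT₁ hT₂ n hn f hf hsymm L hL hLip t ht
  have hfL : MarkovSplit.IsSymmLipschitz n L f := ⟨hf, hsymm, hLip⟩
  have hprob : IsProbabilityMeasure (MarkovSplit.splitLaw h ξ) := by
    unfold MarkovSplit.splitLaw
    infer_instance
  have hτ : 1 ≤ τ := MarkovSplit.one_le_of_psi1Norm_le hT₁ fun w => by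
    simpa [MarkovSplit.interRegenTime_one] using
      ENat.toENNReal_le.2 (MarkovSplit.one_le_waitAfter 0 w)
  have hlt : ENNReal.ofReal τ < ENNReal.ofReal (2 * τ) :=
    (ENNReal.ofReal_lt_ofReal_iff (by linarith)).2 (by linarith)
  have hXm : Measurable (fun ω (i : Fin n) => X i ω) :=
    measurable_pi_lambda _ fun i => hX.measurable i
  have htail : ∀ g : (Fin n → S) → ℝ, MarkovSplit.IsSymmLipschitz n L g →
      μ.real {ω | t ≤ g (fun i => X i ω) - ∫ ω', g (fun i => X i ω') ∂μ} ≤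
        Real.exp (-(t ^ 2 / (384 * n * L ^ 2 * (2 * τ) ^ 2))) := by
    intro g hg
    have hgX : Measurable fun ω => g (fun i => X i ω) := hg.measurable.comp hXm
    obtain ⟨b, hb⟩ := hg.exists_bound hL.le
    refine MarkovSplit.measure_ge_le_of_mgf_le (hgX.sub_const _) hn hL (by linarith) ht ?_
      fun l hl => MarkovSplit.IsSymmLipschitz.mgf_le h hX (by linarith) (hT₁.trans_lt hlt)
        (hT₂.trans_lt hlt) hn hL.le hg hl
    intro ω
    have hi : Integrable (fun ω' => g (fun i => X i ω')) μ :=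
      Integrable.of_bound hgX.aestronglyMeasurable b (Filter.Eventually.of_forall fun _ => hb _)
    have e : g (fun i => X i ω) - ∫ ω', g (fun i => X i ω') ∂μ =
        ∫ ω', (g (fun i => X i ω) - g (fun i => X i ω')) ∂μ := by
      rw [integral_sub (integrable_const _) hi]
      simp
    rw [e]
    simpa using norm_integral_le_of_norm_le_const (μ := μ) (C := L * n)
      (f := fun ω' => g (fun i => X i ω) - g (fun i => X i ω'))
      (Filter.Eventually.of_forall fun ω' => hg.abs_sub_le hL.le _ _)
  have hsub : {ω | t ≤ |f (fun i => X i ω) - ∫ ω', f (fun i => X i ω') ∂μ|} ⊆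
      {ω | t ≤ f (fun i => X i ω) - ∫ ω', f (fun i => X i ω') ∂μ} ∪
        {ω | t ≤ -f (fun i => X i ω) - ∫ ω', -f (fun i => X i ω') ∂μ} := by
    intro ω hω
    rcases le_abs.1 (show t ≤ |_| from hω) with h1 | h1
    · exact Or.inl h1
    · refine Or.inr ?_
      simp only [Set.mem_ofPred_eq, integral_neg]
      linarith
  have e : t ^ 2 / (384 * n * L ^ 2 * (2 * τ) ^ 2) = 1 / 1536 * (t ^ 2 / (n * L ^ 2 * τ ^ 2)) := by
    have : (n : ℝ) ≠ 0 := by exact_mod_cast hn.ne'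
    field_simp
    ring
  calc _ ≤ _ := measureReal_mono hsub
    _ ≤ _ := measureReal_union_le _ _
    _ ≤ _ := add_le_add (htail f hfL) (htail _ hfL.neg)
    _ = _ := by rw [e, two_mul]
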